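/- Let $E$ and $F$ be real inner product spaces (not assumed complete, possibly infinite dimensional), let $n$ be an integer with $3\le n\le\dim E$, and for vectors $x_1,\dots,x_n$ let $\mathrm{Area}_n(x_1,\dots,x_n)$ denote the $n$-dimensional volume of the parallelepiped $\{\sum_{j=1}^n t_jx_j : t_j\in[0,1]\}$ (which is $0$ if the vectors are linearly dependent). Let $\phi\colon E\to F$ be an arbitrary map such that $$\mathrm{Area}_n(x_1,\dots,x_n)=\mathrm{Area}_n(\phi(x_1),\dots,\phi(x_n))\qquad (x_1,\dots,x_n\in E).$$ Then: (i) If $\dim E=n$, there exist a function $\epsilon\colon E\to\{-1,1\}$ and an equiaffine linear map $A\colon E\to F$ such that $\phi(x)=\epsilon(x)Ax$ for all $x\in E$. Here a linear map $A$ is called equiaffine if the matrix of $A$, represented in some orthonormal bases of $E$ and of the range of $A$, has determinant $\pm1$. (ii) If $\dim E>n$, there exist a function $\epsilon\colon E\to\{-1,1\}$ and a (not necessarily surjective) linear isometry $R\colon E\to F$ such that $\phi(x)=\epsilon(x)Rx$ for all $x\in E$. -/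

import Mathlib

open MeasureTheory

/-- The `n`-dimensional volume of the parallelepiped `{∑ j, t j • x j | t j ∈ [0, 1]}` spanned by
`n` vectors of a real inner product space (of arbitrary, possibly infinite, dimension). Here
`μHE[n]` is the `n`-dimensional Hausdorff measure for the inner product metric and the Borel
`σ`-algebra, normalized to agree with Lebesgue measure on `n`-dimensional Euclidean space. -/
noncomputable def nVolume {E : Type*} [NormedAddCommGroup E] [InnerProductSpace ℝ E] {n : ℕ}
    (x : Fin n → E) : ℝ :=
  letI : MeasurableSpace E := borel E
  haveI : BorelSpace E := ⟨rfl⟩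
  (μHE[n] (parallelepiped x)).toReal

/-- An affine map `f : E → F` is equiaffine if the matrix of its linear part, represented in some
(finite, equally indexed) orthonormal bases of `E` and of the range of the linear part, has
determinant `1` or `-1`. -/
def IsEquiaffine {E F : Type*} [NormedAddCommGroup E] [InnerProductSpace ℝ E]
    [NormedAddCommGroup F] [InnerProductSpace ℝ F] (f : E →ᵃ[ℝ] F) : Prop :=
  ∃ (m : ℕ) (b : OrthonormalBasis (Fin m) ℝ E)
    (c : OrthonormalBasis (Fin m) ℝ (LinearMap.range f.linear)),
    (LinearMap.toMatrix b.toBasis c.toBasis f.linear.rangeRestrict).det = 1 ∨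
      (LinearMap.toMatrix b.toBasis c.toBasis f.linear.rangeRestrict).det = -1

open Module

section

variable {E F : Type*} [NormedAddCommGroup E] [InnerProductSpace ℝ E]
  [NormedAddCommGroup F] [InnerProductSpace ℝ F] {n : ℕ}

/-! Squared volume is the Gram determinant, so `φ` preserves Gram determinants. Fix independent `e`
and let `x` have coordinates `a`. Since `3 ≤ n`, `φ x` lies in the span of the `φ (e i)`
(`map_mem_span`); let `b` be its coordinates. Replacing one `e k` by `x` gives `b k ^ 2 = a k ^ 2`;
replacing two entries by `∑ e i` and `x` compares 2×2 minors and fixes the relative signs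
(`exists_map_sum_smul_eq`). So `φ` is linear up to sign on each `n`-dimensional subspace, and these
linear maps glue (`exists_linearMap_of_forall_span_triple`).

The resulting linear map preserves `n`-volumes. In dimension `n` this says its determinant is `±1`;
in larger dimension the eigenvalues of `A* A` on `(n+1)`-dimensional subspaces must all be `1`. -/

theorem nVolume_sq_eq_det_gram (x : Fin n → E) :
    nVolume x ^ 2 = (Matrix.gram ℝ x).det := by
  let _ : MeasurableSpace E := borel E
  have : BorelSpace E := ⟨rfl⟩
  let b := EuclideanSpace.basisFun (Fin n) ℝ
  let f : EuclideanSpace ℝ (Fin n) →ₗ[ℝ] E := b.toBasis.constr ℝ x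
  have hf : ∀ i, f (b i) = x i := fun i => by
    rw [← b.coe_toBasis, b.toBasis.constr_basis]
  have himg : parallelepiped x = f '' parallelepiped b := by
    rw [image_parallelepiped]
    congr 1
    exact funext fun i => (hf i).symm
  have hvol : μHE[n] (parallelepiped x) = ENNReal.ofReal f.normDet := by
    have h := f.euclideanHausdorffMeasure_image_eq_normDet_mul_volume (parallelepiped b)
    rw [b.volume_parallelepiped, mul_one, finrank_euclideanSpace_fin] at h
    rw [himg, h]
  have hn : nVolume x = f.normDet := by
    change (μHE[n] (parallelepiped x)).toReal = _
    rw [hvol, ENNReal.toReal_ofReal f.normDet_nonneg]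
  have h := f.normDet_sq_eq_det_gram b
  simp only [hf] at h
  rw [hn]
  exact h

/-! ### Gram determinants after replacing one or two vectors -/

namespace Matrix

theorem det_gram_sum_smul (M : Matrix (Fin n) (Fin n) ℝ) (v : Fin n → E) :
    (gram ℝ fun i => ∑ j, M i j • v j).det = M.det ^ 2 * (gram ℝ v).det := by
  have h : gram ℝ (fun i => ∑ j, M i j • v j) = M * gram ℝ v * Mᵀ := by
    ext i j
    simp only [gram_apply, mul_apply, transpose_apply, sum_inner, inner_sum, inner_smul_left,
      inner_smul_right, Finset.sum_mul]
    refine Finset.sum_congr rfl fun k _ => ?_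
    rw [Finset.mul_sum]
    refine Finset.sum_congr rfl fun l _ => ?_
    simp
    ring
  rw [h, det_mul, det_mul, det_transpose]
  ring

theorem det_one_updateRow (k : Fin n) (a : Fin n → ℝ) :
    ((1 : Matrix (Fin n) (Fin n) ℝ).updateRow k a).det = a k := by
  rw [← cramer_transpose_apply, transpose_one, cramer_one]
  rfl

theorem det_one_updateRow_updateRow {i j : Fin n} (hij : i ≠ j) (u a : Fin n → ℝ) (hu : u i ≠ 0) :
    (((1 : Matrix (Fin n) (Fin n) ℝ).updateRow i u).updateRow j a).det =
      u i * a j - a i * u j := by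
  set P := (1 : Matrix (Fin n) (Fin n) ℝ).updateRow i u with hP
  have hPi : P i = u := by simp [hP]
  have hPne : ∀ k, k ≠ i → P k = Pi.single k 1 := fun k hk => by
    rw [hP, updateRow_ne hk]
    ext l
    simp [one_apply, Pi.single_apply, eq_comm]
  -- The coordinates of `a` in the rows of `P`, which are `u` and the unit vectors other than the
  -- `i`-th.
  let c : Fin n → ℝ := fun k => if k = i then a i / u i else a k - a i / u i * u k
  have hc : P.updateRow j a = (1 : Matrix (Fin n) (Fin n) ℝ).updateRow j c * P := by
    ext k l
    by_cases hk : k = j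
    · subst hk
      rw [updateRow_self, mul_apply, updateRow_self,
        ← Finset.add_sum_erase _ _ (Finset.mem_univ i), hPi]
      have : ∑ m ∈ Finset.univ.erase i, c m * P m l =
          ∑ m ∈ Finset.univ.erase i, if m = l then c m else 0 := by
        refine Finset.sum_congr rfl fun m hm => ?_
        rw [hPne m (Finset.ne_of_mem_erase hm)]
        simp [Pi.single_apply, eq_comm]
      rw [this, Finset.sum_ite_eq']
      by_cases hl : l = i
      · subst hl; simp [c]; field_simp
      · simp [c, hl]
    · rw [updateRow_ne hk, mul_apply]
      simp [updateRow_ne hk, one_apply]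
  rw [hc, det_mul, det_one_updateRow, hP, det_one_updateRow]
  simp only [c, if_neg hij.symm]
  field_simp

end Matrix

theorem sum_one_updateRow_smul (k : Fin n) (a : Fin n → ℝ) (v : Fin n → E) :
    (fun i => ∑ j, ((1 : Matrix (Fin n) (Fin n) ℝ).updateRow k a) i j • v j) =
      Function.update v k (∑ j, a j • v j) := by
  ext i
  by_cases hi : i = k
  · subst hi; simp
  · simp [hi, Matrix.one_apply]

theorem det_gram_update (k : Fin n) (a : Fin n → ℝ) (v : Fin n → E) :
    (Matrix.gram ℝ (Function.update v k (∑ j, a j • v j))).det =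
      a k ^ 2 * (Matrix.gram ℝ v).det := by
  rw [← sum_one_updateRow_smul, Matrix.det_gram_sum_smul, Matrix.det_one_updateRow]

theorem det_gram_update_update {i j : Fin n} (hij : i ≠ j) (u a : Fin n → ℝ) (hu : u i ≠ 0)
    (v : Fin n → E) :
    (Matrix.gram ℝ (Function.update (Function.update v i (∑ k, u k • v k)) j
      (∑ k, a k • v k))).det = (u i * a j - a i * u j) ^ 2 * (Matrix.gram ℝ v).det := by
  rw [← Matrix.det_one_updateRow_updateRow hij u a hu, ← Matrix.det_gram_sum_smul]
  congr 3
  ext k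
  by_cases hk : k = j
  · subst hk; simp
  · rw [Function.update_of_ne hk, Matrix.updateRow_ne hk, ← sum_one_updateRow_smul]

theorem update_comp_apply {α β : Type*} (φ : α → β) (x : Fin n → α) (k : Fin n) (y : α) :
    (fun i => φ (Function.update x k y i)) = Function.update (fun i => φ (x i)) k (φ y) :=
  Function.comp_update φ x k y

/-! ### Coordinates of `φ x` on an `n`-dimensional subspace -/

variable {φ : E → F}

theorem linearIndependent_comp_of_det_gram_eq
    (hφ : ∀ x : Fin n → E, (Matrix.gram ℝ x).det = (Matrix.gram ℝ fun i => φ (x i)).det)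
    {e : Fin n → E} (he : LinearIndependent ℝ e) : LinearIndependent ℝ fun i => φ (e i) := by
  rw [← Matrix.det_gram_ne_zero_iff_linearIndependent] at he ⊢
  rwa [← hφ]

theorem map_mem_span_of_coeff_eq_zero
    (hφ : ∀ x : Fin n → E, (Matrix.gram ℝ x).det = (Matrix.gram ℝ fun i => φ (x i)).det)
    {e : Fin n → E} (he : LinearIndependent ℝ e) {a : Fin n → ℝ} {k : Fin n} (ha : a k = 0) :
    φ (∑ i, a i • e i) ∈ Submodule.span ℝ (Set.range fun i => φ (e i)) := by
  have hg := linearIndependent_comp_of_det_gram_eq hφ he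
  have h := hφ (Function.update e k (∑ i, a i • e i))
  rw [det_gram_update, ha, update_comp_apply] at h
  have hdep : ¬ LinearIndependent ℝ
      (Function.update (fun i => φ (e i)) k (φ (∑ i, a i • e i))) := by
    rw [← Matrix.det_gram_ne_zero_iff_linearIndependent, ← h]
    simp
  set w := φ (∑ i, a i • e i)
  rw [Fintype.not_linearIndependent_iff] at hdep
  obtain ⟨c, hc, hne⟩ := hdep
  have hsplit : ∑ i ∈ Finset.univ.erase k, c i • φ (e i) =
      ∑ i ∈ Finset.univ.erase k, c i • Function.update (fun i => φ (e i)) k w i :=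
    Finset.sum_congr rfl fun i hi => by rw [Function.update_of_ne (Finset.ne_of_mem_erase hi)]
  rw [← Finset.add_sum_erase _ _ (Finset.mem_univ k), Function.update_self, ← hsplit] at hc
  have hmem : ∑ i ∈ Finset.univ.erase k, c i • φ (e i) ∈
      Submodule.span ℝ (Set.range fun i => φ (e i)) :=
    Submodule.sum_mem _ fun i _ => Submodule.smul_mem _ _ (Submodule.subset_span ⟨i, rfl⟩)
  by_cases hck : c k = 0
  · rw [hck, zero_smul, zero_add] at hc
    have h0 : ∑ i, c i • φ (e i) = 0 := by
      rw [← Finset.add_sum_erase _ _ (Finset.mem_univ k), hck, zero_smul, zero_add, hc]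
    obtain ⟨i, hi⟩ := hne
    exact absurd (Fintype.linearIndependent_iff.1 hg c h0 i) hi
  · rw [← Submodule.smul_mem_iff _ hck, eq_neg_of_add_eq_zero_left hc]
    exact Submodule.neg_mem _ hmem

theorem map_mem_span
    (hφ : ∀ x : Fin n → E, (Matrix.gram ℝ x).det = (Matrix.gram ℝ fun i => φ (x i)).det)
    (hn : 3 ≤ n) {e : Fin n → E} (he : LinearIndependent ℝ e) (a : Fin n → ℝ) :
    φ (∑ i, a i • e i) ∈ Submodule.span ℝ (Set.range fun i => φ (e i)) := by
  let i0 : Fin n := ⟨0, by omega⟩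
  let i1 : Fin n := ⟨1, by omega⟩
  let i2 : Fin n := ⟨2, by omega⟩
  have h01 : i0 ≠ i1 := by simp [i0, i1]
  have h02 : i2 ≠ i0 := by simp [i0, i2]
  have h12 : i2 ≠ i1 := by simp [i1, i2]
  by_cases ha : a i1 = 0
  · exact map_mem_span_of_coeff_eq_zero hφ he ha
  -- Drop the `i0` term of `x` to get `y`, and put `y` in place of `e i1`. Then `x = a i0 • e i0 +
  -- y` has zero `i2` coordinate in the new basis; a third index is needed here.
  let c := Function.update a i0 0
  let y := ∑ i, c i • e i
  have hc0 : c i0 = 0 := by simp [c]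
  have hy : φ y ∈ Submodule.span ℝ (Set.range fun i => φ (e i)) :=
    map_mem_span_of_coeff_eq_zero hφ he hc0
  have he' : LinearIndependent ℝ (Function.update e i1 y) := by
    rw [← Matrix.det_gram_ne_zero_iff_linearIndependent, det_gram_update]
    refine mul_ne_zero (pow_ne_zero 2 ?_) (Matrix.det_gram_ne_zero_iff_linearIndependent.2 he)
    simpa [c, h01.symm] using ha
  let d : Fin n → ℝ := Pi.single i0 (a i0) + Pi.single i1 1
  have hd2 : d i2 = 0 := by simp [d, h02, h12]
  have hx : ∑ i, a i • e i = ∑ i, d i • Function.update e i1 y i := by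
    have h1 : ∑ i, d i • Function.update e i1 y i = a i0 • e i0 + y := by
      simp [d, add_smul, Finset.sum_add_distrib, Pi.single_apply, ite_smul, h01]
    have h2 : ∑ i ∈ Finset.univ.erase i0, c i • e i = ∑ i ∈ Finset.univ.erase i0, a i • e i :=
      Finset.sum_congr rfl fun i hi => by simp [c, Finset.ne_of_mem_erase hi]
    rw [h1, ← Finset.add_sum_erase _ _ (Finset.mem_univ i0)]
    simp only [y]
    rw [← Finset.add_sum_erase _ (fun i => c i • e i) (Finset.mem_univ i0), hc0, zero_smul,
      zero_add, h2]
  rw [hx]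
  refine Submodule.span_le.2 ?_ (map_mem_span_of_coeff_eq_zero hφ he' hd2)
  rintro _ ⟨i, rfl⟩
  by_cases hi : i = i1
  · subst hi; simpa using hy
  · simp only [Function.update_of_ne hi]
    exact Submodule.subset_span ⟨i, rfl⟩

theorem eq_or_eq_neg_of_mul_eq_mul {ι : Type*} {a c : ι → ℝ} (h : ∀ i j, c i * c j = a i * a j) :
    c = a ∨ c = -a := by
  by_cases ha : a = 0
  · left
    ext i
    have := h i i
    simpa [ha] using this
  obtain ⟨i, hi⟩ := Function.ne_iff.1 ha
  simp only [Pi.zero_apply] at hi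
  rcases mul_self_eq_mul_self_iff.1 (h i i) with hci | hci
  · left
    ext j
    have := h i j
    rw [hci] at this
    exact mul_left_cancel₀ hi this
  · right
    ext j
    have := h i j
    rw [hci] at this
    rw [Pi.neg_apply]
    exact mul_left_cancel₀ hi (by linarith)

theorem exists_map_sum_smul_eq
    (hφ : ∀ x : Fin n → E, (Matrix.gram ℝ x).det = (Matrix.gram ℝ fun i => φ (x i)).det)
    (hn : 3 ≤ n) {e : Fin n → E} (he : LinearIndependent ℝ e) :
    ∃ f : Fin n → F, ∀ a : Fin n → ℝ,
      φ (∑ i, a i • e i) = ∑ i, a i • f i ∨ φ (∑ i, a i • e i) = -∑ i, a i • f i := by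
  have hD := Matrix.det_gram_ne_zero_iff_linearIndependent.2 he
  have hcoord : ∀ a : Fin n → ℝ, ∃ b : Fin n → ℝ, ∑ i, b i • φ (e i) = φ (∑ i, a i • e i) :=
    fun a => (Submodule.mem_span_range_iff_exists_fun ℝ).1 (map_mem_span hφ hn he a)
  choose b hb using hcoord
  have hsq : ∀ a k, b a k ^ 2 = a k ^ 2 := fun a k => by
    have h := hφ (Function.update e k (∑ i, a i • e i))
    rw [update_comp_apply, ← hb, det_gram_update, det_gram_update, ← hφ] at h
    exact (mul_right_cancel₀ hD h).symm
  -- Coordinates of `φ (∑ e i)`, all `±1`: they calibrate the signs of the `φ (e i)`.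
  let s := b 1
  have hs : ∀ k, s k * s k = 1 := fun k => by simpa [sq] using hsq 1 k
  have hs0 : ∀ k, s k ≠ 0 := fun k h => by simpa [h] using hs k
  refine ⟨fun i => s i • φ (e i), fun a => ?_⟩
  have hprod : ∀ i j, (s i * b a i) * (s j * b a j) = a i * a j := fun i j => by
    have hii := hsq a i
    have hjj := hsq a j
    by_cases hij : i = j
    · subst hij
      linear_combination hii + b a i ^ 2 * hs i
    have h := hφ (Function.update (Function.update e i
      (∑ k, (1 : Fin n → ℝ) k • e k)) j (∑ k, a k • e k))
    rw [update_comp_apply, update_comp_apply, ← hb, ← hb,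
      det_gram_update_update hij _ _ (hs0 i), det_gram_update_update hij _ _ (by simp), ← hφ] at h
    have h' := mul_right_cancel₀ hD h
    simp only [Pi.one_apply] at h'
    change _ = (s i * b a j - b a i * s j) ^ 2 at h'
    -- Once the squares are expanded and cancelled, only the cross terms remain.
    linear_combination (1 / 2) * h' + (1 / 2) * hii + (1 / 2) * hjj +
      (b a j ^ 2 / 2) * hs i + (b a i ^ 2 / 2) * hs j
  have hφa : φ (∑ i, a i • e i) = ∑ i, (s i * b a i) • s i • φ (e i) := by
    rw [← hb]
    refine Finset.sum_congr rfl fun i _ => ?_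
    rw [smul_smul]
    congr 1
    linear_combination -b a i * hs i
  rw [hφa]
  rcases eq_or_eq_neg_of_mul_eq_mul hprod with h | h
  · left
    exact Finset.sum_congr rfl fun i _ => by rw [congrFun h i]
  · right
    rw [← Finset.sum_neg_distrib]
    exact Finset.sum_congr rfl fun i _ => by rw [congrFun h i, Pi.neg_apply, neg_smul]

theorem det_gram_eq_of_eq_or_eq_neg {y z : Fin n → E} (h : ∀ i, y i = z i ∨ y i = -z i) :
    (Matrix.gram ℝ y).det = (Matrix.gram ℝ z).det := by
  have hs : ∀ i, ∃ s : ℝ, s ^ 2 = 1 ∧ y i = s • z i := fun i => by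
    rcases h i with h | h
    · exact ⟨1, by simp, by simp [h]⟩
    · exact ⟨-1, by simp, by simp [h]⟩
  choose s hs1 hs using hs
  have hy : y = fun i => ∑ j, Matrix.diagonal s i j • z j := by
    ext i
    simp [hs, Matrix.diagonal_apply]
  rw [hy, Matrix.det_gram_sum_smul, Matrix.det_diagonal, ← Finset.prod_pow]
  simp [hs1]

/-! ### Gluing local linear maps -/

theorem exists_linearIndependent_extend {V : Type*} [AddCommGroup V] [Module ℝ V] {m k : ℕ}
    (hmk : m ≤ k) (hk : (k : Cardinal) ≤ Module.rank ℝ V) {e : Fin m → V}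
    (he : LinearIndependent ℝ e) :
    ∃ e' : Fin k → V, LinearIndependent ℝ e' ∧
      Submodule.span ℝ (Set.range e) ≤ Submodule.span ℝ (Set.range e') := by
  induction k, hmk using Nat.le_induction with
  | base => exact ⟨e, he, le_rfl⟩
  | succ k _ ih =>
    have hlt : (k : Cardinal) < Module.rank ℝ V :=
      lt_of_lt_of_le (by exact_mod_cast Nat.lt_succ_self k) hk
    obtain ⟨e', he', hle⟩ := ih hlt.le
    obtain ⟨x, hx⟩ := exists_linearIndependent_snoc_of_lt_rank he' hlt
    refine ⟨_, hx, hle.trans (Submodule.span_mono ?_)⟩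
    rintro _ ⟨i, rfl⟩
    exact ⟨i.castSucc, by simp⟩

theorem exists_linearIndependent_le_span {V : Type*} [AddCommGroup V] [Module ℝ V] {k : ℕ}
    (hk : (k : Cardinal) ≤ Module.rank ℝ V) (s : Finset V) (hs : s.card ≤ k) :
    ∃ e : Fin k → V, LinearIndependent ℝ e ∧
      (s : Set V) ⊆ Submodule.span ℝ (Set.range e) := by
  let W := Submodule.span ℝ (s : Set V)
  let b := finBasis ℝ W
  have hb : LinearIndependent ℝ fun i => (b i : V) :=
    b.linearIndependent.map' W.subtype W.ker_subtype
  obtain ⟨e, he, hle⟩ :=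
    exists_linearIndependent_extend ((finrank_span_finset_le_card s).trans hs) hk hb
  refine ⟨e, he, Submodule.subset_span.trans (le_trans (α := Submodule ℝ V) ?_ hle)⟩
  have h := congrArg (Submodule.map W.subtype) b.span_eq
  rw [Submodule.map_span, Submodule.map_top, Submodule.range_subtype, ← Set.range_comp] at h
  exact h.ge

theorem LinearIndependent.exists_linearMap_apply_eq {V V' : Type*} [AddCommGroup V] [Module ℝ V]
    [AddCommGroup V'] [Module ℝ V'] {e : Fin n → V} (he : LinearIndependent ℝ e)
    (f : Fin n → V') : ∃ A : V →ₗ[ℝ] V', ∀ i, A (e i) = f i := by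
  obtain ⟨A, hA⟩ := LinearMap.exists_extend ((Basis.span he).constr ℝ f)
  refine ⟨A, fun i => ?_⟩
  have h := LinearMap.congr_fun hA (Basis.span he i)
  rw [Basis.constr_basis, LinearMap.comp_apply, Submodule.subtype_apply,
    Basis.span_apply] at h
  exact h

/-- Each local map is unique up to sign, and requiring the value `φ x₀` at `x₀` removes the
ambiguity. Besides `x₀`, two vectors suffice to test additivity. -/
theorem exists_linearMap_of_forall_span_triple {V V' : Type*} [AddCommGroup V] [Module ℝ V]
    [AddCommGroup V'] [Module ℝ V'] {φ : V → V'} {x₀ : V} (h₀ : φ x₀ ≠ 0)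
    (h : ∀ y z, ∃ A : V →ₗ[ℝ] V', ∀ v ∈ Submodule.span ℝ {x₀, y, z}, φ v = A v ∨ φ v = -A v) :
    ∃ T : V →ₗ[ℝ] V', ∀ v, φ v = T v ∨ φ v = -T v := by
  have h' : ∀ y z, ∃ A : V →ₗ[ℝ] V', A x₀ = φ x₀ ∧
      ∀ v ∈ Submodule.span ℝ {x₀, y, z}, φ v = A v ∨ φ v = -A v := fun y z => by
    obtain ⟨A, hA⟩ := h y z
    rcases hA x₀ (Submodule.subset_span (by simp)) with hx | hx
    · exact ⟨A, hx.symm, hA⟩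
    · exact ⟨-A, hx.symm, fun v hv => by simpa [or_comm] using hA v hv⟩
  choose A hA₀ hA using h'
  have huniq : ∀ y z y' z' v, v ∈ Submodule.span ℝ {x₀, y, z} → v ∈ Submodule.span ℝ {x₀, y', z'} →
      A y z v = A y' z' v := fun y z y' z' v hv hv' => by
    have hx : x₀ ∈ Submodule.span ℝ {x₀, y, z} := Submodule.subset_span (by simp)
    have hx' : x₀ ∈ Submodule.span ℝ {x₀, y', z'} := Submodule.subset_span (by simp)
    have pm : ∀ w ∈ Submodule.span ℝ {x₀, y, z}, w ∈ Submodule.span ℝ {x₀, y', z'} →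
        A y z w = A y' z' w ∨ A y z w = -A y' z' w := fun w hw hw' => by
      rcases hA y z w hw with h1 | h1 <;> rcases hA y' z' w hw' with h2 | h2 <;> rw [h1] at h2
      · exact Or.inl h2
      · exact Or.inr h2
      · exact Or.inr (neg_eq_iff_eq_neg.1 h2)
      · exact Or.inl (neg_injective h2)
    rcases pm v hv hv' with h1 | h1
    · exact h1
    -- If the two maps are opposite at `v`, being opposite at `x₀ + v` too would force `2 • φ x₀ =
    -- 0`.
    rcases pm (x₀ + v) (Submodule.add_mem _ hx hv) (Submodule.add_mem _ hx' hv') with h2 | h2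
    · rw [map_add, map_add, hA₀, hA₀] at h2
      exact add_left_cancel h2
    · rw [map_add, map_add, hA₀, hA₀, h1, neg_add] at h2
      have h3 : (2 : ℝ) • φ x₀ = 0 := by
        rw [two_smul]
        exact add_eq_zero_iff_eq_neg.2 (add_right_cancel h2)
      exact absurd ((smul_eq_zero_iff_right two_ne_zero).1 h3) h₀
  have mem₂ : ∀ y z, y ∈ Submodule.span ℝ {x₀, y, z} := fun y z =>
    Submodule.subset_span (by simp)
  have mem₃ : ∀ y z, z ∈ Submodule.span ℝ {x₀, y, z} := fun y z =>
    Submodule.subset_span (by simp)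
  refine ⟨{ toFun := fun y => A y y y, map_add' := fun y z => ?_, map_smul' := fun c y => ?_ },
    fun v => hA v v v (mem₂ v v)⟩
  · rw [huniq y y y z y (mem₂ _ _) (mem₂ _ _), huniq z z y z z (mem₂ _ _) (mem₃ _ _), ← map_add]
    exact huniq _ _ _ _ _ (mem₂ _ _) (Submodule.add_mem _ (mem₂ _ _) (mem₃ _ _))
  · rw [RingHom.id_apply, ← map_smul]
    exact huniq _ _ _ _ _ (mem₂ _ _) (Submodule.smul_mem _ _ (mem₂ _ _))

/-! ### Linear maps preserving `n`-volumes -/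

theorem norm_map_of_det_gram_eq (hn : n ≠ 0) (hdim : (n : Cardinal) < Module.rank ℝ E)
    (A : E →ₗ[ℝ] F)
    (hA : ∀ x : Fin n → E, (Matrix.gram ℝ x).det = (Matrix.gram ℝ fun i => A (x i)).det) (x : E) :
    ‖A x‖ = ‖x‖ := by
  have hdim' : ((n + 1 : ℕ) : Cardinal) ≤ Module.rank ℝ E := by
    rw [Nat.cast_add_one, ← Cardinal.succ_natCast]
    exact Order.succ_le_of_lt hdim
  obtain ⟨e, he, hxe⟩ := exists_linearIndependent_le_span hdim' {x} (by simp)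
  let V := Submodule.span ℝ (Set.range e)
  have hV : finrank ℝ V = n + 1 := by
    simpa using finrank_span_eq_card he
  have : FiniteDimensional ℝ V := .of_finrank_pos (by omega)
  have hxV : x ∈ V := hxe (by simp)
  let B := (A.domRestrict V).rangeRestrict
  let S := B.adjoint ∘ₗ B
  have hinner : ∀ v w : V, inner ℝ (S v) w = inner ℝ (A v) (A w) := fun v w => by
    simp only [S, LinearMap.comp_apply, LinearMap.adjoint_inner_left]
    rfl
  have hS : S.IsSymmetric := fun v w => by
    rw [hinner, real_inner_comm, ← hinner, real_inner_comm]
  let b := hS.eigenvectorBasis hV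
  let l := hS.eigenvalues hV
  have hb : ∀ i, S (b i) = l i • b i := fun i => hS.apply_eigenvectorBasis hV i
  have hAb : ∀ i j, inner ℝ (A (b i)) (A (b j)) = if i = j then l i else 0 := fun i j => by
    rw [← hinner, hb, inner_smul_left, orthonormal_iff_ite.1 b.orthonormal]
    simp
  -- Omitting one of the `n + 1` eigenvectors leaves an orthonormal `n`-tuple whose image is
  -- orthogonal.
  have hprod : ∀ k : Fin (n + 1), ∏ i, l (k.succAbove i) = 1 := fun k => by
    have h := hA fun i => b (k.succAbove i)
    have h1 : Matrix.gram ℝ (fun i => (b (k.succAbove i) : E)) = 1 := by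
      rw [Matrix.gram_eq_one_iff_orthonormal]
      exact (b.orthonormal.comp _ k.succAbove_right_injective).comp_linearIsometry V.subtypeₗᵢ
    have h2 : Matrix.gram ℝ (fun i => A (b (k.succAbove i))) =
        Matrix.diagonal fun i => l (k.succAbove i) := by
      ext i j
      rw [Matrix.gram_apply, hAb, Matrix.diagonal_apply]
      simp
    rw [h1, h2, Matrix.det_one, Matrix.det_diagonal] at h
    exact h.symm
  -- All eigenvalues thus equal their total product `P`, and `P ^ n = 1` with `P ≥ 0` gives `P = 1`.
  have hl : ∀ k, l k = ∏ i, l i := fun k => by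
    rw [Fin.prod_univ_succAbove l k, hprod, mul_one]
  have hP0 : 0 ≤ ∏ i, l i := by
    rw [← hl 0]
    have h := hAb 0 0
    rw [if_pos rfl] at h
    rw [← h]
    exact real_inner_self_nonneg
  have hP : ∏ i, l i = 1 := by
    have h := hprod 0
    rw [Finset.prod_congr rfl fun i _ => hl ((0 : Fin (n + 1)).succAbove i), Finset.prod_const,
      Finset.card_univ, Fintype.card_fin] at h
    exact (pow_eq_one_iff_of_nonneg hP0 hn).1 h
  have hS1 : S = LinearMap.id := b.toBasis.ext fun i => by
    rw [b.coe_toBasis, hb, hl, hP, one_smul, LinearMap.id_apply]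
  have h := hinner ⟨x, hxV⟩ ⟨x, hxV⟩
  rw [hS1, LinearMap.id_apply, real_inner_self_eq_norm_sq, real_inner_self_eq_norm_sq] at h
  exact ((sq_eq_sq₀ (norm_nonneg _) (norm_nonneg _)).1 h).symm

theorem exists_sign_of_eq_or_eq_neg {X V : Type*} [AddCommGroup V] [Module ℝ V]
    {φ T : X → V} (h : ∀ x, φ x = T x ∨ φ x = -T x) :
    ∃ ε : X → ({-1, 1} : Set ℝ), ∀ x, φ x = (ε x : ℝ) • T x := by
  have h' : ∀ x, ∃ s : ({-1, 1} : Set ℝ), φ x = (s : ℝ) • T x := fun x => by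
    rcases h x with h | h
    · exact ⟨⟨1, by simp⟩, by simp [h]⟩
    · exact ⟨⟨-1, by simp⟩, by simp [h]⟩
  choose ε hε using h'
  exact ⟨ε, hε⟩

theorem exists_linearMap_of_linearIndependent
    (hφ : ∀ x : Fin n → E, (Matrix.gram ℝ x).det = (Matrix.gram ℝ fun i => φ (x i)).det)
    (hn : 3 ≤ n) {e : Fin n → E} (he : LinearIndependent ℝ e) :
    ∃ A : E →ₗ[ℝ] F, ∀ v ∈ Submodule.span ℝ (Set.range e), φ v = A v ∨ φ v = -A v := by
  obtain ⟨f, hf⟩ := exists_map_sum_smul_eq hφ hn he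
  obtain ⟨A, hA⟩ := he.exists_linearMap_apply_eq f
  refine ⟨A, fun v hv => ?_⟩
  obtain ⟨a, rfl⟩ := (Submodule.mem_span_range_iff_exists_fun ℝ).1 hv
  simpa [hA] using hf a

theorem det_gram_map_eq
    (hφ : ∀ x : Fin n → E, (Matrix.gram ℝ x).det = (Matrix.gram ℝ fun i => φ (x i)).det)
    {A : E →ₗ[ℝ] F} (hA : ∀ x, φ x = A x ∨ φ x = -A x) (x : Fin n → E) :
    (Matrix.gram ℝ x).det = (Matrix.gram ℝ fun i => A (x i)).det :=
  (hφ x).trans (det_gram_eq_of_eq_or_eq_neg fun i => hA (x i))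

theorem isEquiaffine_of_det_gram_eq [FiniteDimensional ℝ E] (A : E →ₗ[ℝ] F)
    (hA : ∀ x : Fin (finrank ℝ E) → E,
      (Matrix.gram ℝ x).det = (Matrix.gram ℝ fun i => A (x i)).det) :
    IsEquiaffine A.toAffineMap := by
  let b := stdOrthonormalBasis ℝ E
  have h1 : A.normDet ^ 2 = 1 := by
    have h := A.normDet_sq_eq_det_gram b
    rw [← hA, Matrix.gram_eq_one_iff_orthonormal.2 b.orthonormal, Matrix.det_one] at h
    exact h
  have hne : A.normDet ≠ 0 := fun h => by simp [h] at h1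
  have hnd : A.normDet = 1 := (pow_eq_one_iff_of_nonneg A.normDet_nonneg two_ne_zero).1 h1
  -- `A` is injective, so its range has an orthonormal basis with the same index set.
  obtain ⟨c⟩ := (A.normDet_ne_zero_tfae.out 0 3).1 hne
  refine ⟨finrank ℝ E, b, c, ?_⟩
  have h := A.normDet_eq_norm_det_toMatrix_rangeRestrict b c
  rw [hnd, Real.norm_eq_abs] at h
  exact eq_or_eq_neg_of_abs_eq h.symm

theorem exists_linearMap_eq_or_eq_neg
    (hφ : ∀ x : Fin n → E, (Matrix.gram ℝ x).det = (Matrix.gram ℝ fun i => φ (x i)).det)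
    (hn : 3 ≤ n) (hdim : (n : Cardinal) ≤ Module.rank ℝ E) :
    ∃ A : E →ₗ[ℝ] F, ∀ x, φ x = A x ∨ φ x = -A x := by
  classical
  obtain ⟨e, he, -⟩ := exists_linearIndependent_le_span hdim ∅ (by simp)
  refine exists_linearMap_of_forall_span_triple (x₀ := e ⟨0, by omega⟩)
    ((linearIndependent_comp_of_det_gram_eq hφ he).ne_zero _) fun y z => ?_
  -- Three vectors fit in an `n`-dimensional subspace because `3 ≤ n`.
  obtain ⟨e', he', hsub⟩ := exists_linearIndependent_le_span hdim {e ⟨0, by omega⟩, y, z}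
    (Finset.card_le_three.trans hn)
  obtain ⟨A, hA⟩ := exists_linearMap_of_linearIndependent hφ hn he'
  refine ⟨A, fun v hv => hA v (Submodule.span_le.2 ?_ hv)⟩
  simpa using hsub

end

theorem mainTheorem3 {E F : Type*} [NormedAddCommGroup E] [InnerProductSpace ℝ E]
    [NormedAddCommGroup F] [InnerProductSpace ℝ F] (n : ℕ) (hn : 3 ≤ n)
    (hdim : (n : Cardinal) ≤ Module.rank ℝ E) (φ : E → F)
    (hφ : ∀ x : Fin n → E, nVolume x = nVolume (fun i => φ (x i))) :
    (Module.rank ℝ E = n →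
      ∃ (ε : E → ({-1, 1} : Set ℝ)) (A : E →ₗ[ℝ] F),
        IsEquiaffine A.toAffineMap ∧ ∀ x, φ x = (ε x : ℝ) • A x) ∧
    ((n : Cardinal) < Module.rank ℝ E →
      ∃ (ε : E → ({-1, 1} : Set ℝ)) (R : E →ₗᵢ[ℝ] F), ∀ x, φ x = (ε x : ℝ) • R x) := by
  have hgram : ∀ x : Fin n → E,
      (Matrix.gram ℝ x).det = (Matrix.gram ℝ fun i => φ (x i)).det := fun x => by
    rw [← nVolume_sq_eq_det_gram, ← nVolume_sq_eq_det_gram, hφ]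
  obtain ⟨A, hA⟩ := exists_linearMap_eq_or_eq_neg hgram hn hdim
  have hAgram := det_gram_map_eq hgram hA
  obtain ⟨ε, hε⟩ := exists_sign_of_eq_or_eq_neg hA
  constructor
  · intro hrank
    have hfin : finrank ℝ E = n := finrank_eq_of_rank_eq hrank
    have : FiniteDimensional ℝ E := .of_finrank_pos (by omega)
    subst hfin
    exact ⟨ε, A, isEquiaffine_of_det_gram_eq A hAgram, hε⟩
  · intro hlt
    exact ⟨ε, ⟨A, norm_map_of_det_gram_eq (by omega) hlt A hAgram⟩, hε⟩
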